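/- Let $G$ be a (finite-dimensional, real, smooth) Lie group whose Lie algebra is perfect, that is, spanned by the brackets $[x,y]$ with $x,y\in\operatorname{Lie}(G)$; no countability assumption is made on $G$. Let $H$ be a topological group, and let $\psi:G\to H$ be an abstract group homomorphism (not assumed continuous). Call a subset $C\subseteq G$ spacious if there exist $r\ge 1$ and $g_1,\dots,g_r\in G$ such that the product $g_1CC^{-1}\,g_2CC^{-1}\cdots g_rCC^{-1}$ has nonempty interior in $G$. If there exists a compact spacious set $C\subseteq G$ whose image $\psi(C)$ has compact closure in $H$, then $\psi$ is continuous. -/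

import Mathlib

open scoped Manifold ContDiff Pointwise

/-- A subset `C` of a topological group is *spacious* if some product
`(g₁ C C⁻¹) (g₂ C C⁻¹) ⋯ (gᵣ C C⁻¹)`, `r ≥ 1`, of finitely many left translates of `C C⁻¹`
has nonempty interior. -/
def IsSpacious {G : Type*} [Group G] [TopologicalSpace G] (C : Set G) : Prop :=
  ∃ l : List G, l ≠ [] ∧ (interior (l.map fun g => g • (C * C⁻¹)).prod).Nonempty

/-- The Lie algebra of the real Lie group `G` (the tangent space at `1`, with the bracket of
left-invariant vector fields) is *perfect*: it is spanned by the brackets `⁅x, y⁆`. -/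
def HasPerfectLieAlgebra {E : Type*} [NormedAddCommGroup E] [NormedSpace ℝ E]
    {M : Type*} [TopologicalSpace M] (I : ModelWithCorners ℝ E M)
    (G : Type*) [TopologicalSpace G] [ChartedSpace M G] [Group G] : Prop :=
  Submodule.span ℝ {z : GroupLieAlgebra I G | ∃ x y : GroupLieAlgebra I G, ⁅x, y⁆ = z} = ⊤

/-! The differential of `Ad` at `1` is the bracket, so perfectness says that the operators `ad (y
i)`, for a basis `y` of the Lie algebra, have jointly full range. This survives passing to
difference quotients, hence to `Ad (g s) - Ad (g t)` for small `s ≠ t` along each coordinate line in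
the chart (`HasStrictFDerivAt.eventually_surjective_sum_sub`). Put `x i = g t * (g s)⁻¹`. Factoring
out `Ad (g s)` shows that the `1 - Ad (x i)` have jointly full range, and then products of
commutators of `h i` with `x i`, with `h i` near `1`, fill a neighbourhood of `1`
(`eventually_exists_prod_commutator`).

Spaciousness makes `ψ` relatively compact on a neighbourhood of `1`. By pigeonhole in a compact set,
`s ≠ t` can be chosen with `ψ (x i)` as close to `1` as desired. Each `ψ (h i)` stays in a fixed
compact set, so its commutator with `ψ (x i)` is close to `1`. Thus `ψ` sends a whole neighbourhood
of `1` into a prescribed one. -/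

open Filter Topology

/-! ### First-order calculus of the group operations in the chart at `1`. -/

namespace LieGroupChart

variable {E : Type*} [NormedAddCommGroup E] [NormedSpace ℝ E]
  {M : Type*} [TopologicalSpace M] (I : ModelWithCorners ℝ E M)
  {G : Type*} [TopologicalSpace G] [ChartedSpace M G] [Group G]

/-- The differential, at the base point of the preferred chart at `1`, of a map `J : G → G` read
in that chart. -/
noncomputable def chartDeriv (J : G → G) : E →L[ℝ] E :=
  fderiv ℝ (fun w => extChartAt I (1 : G) (J ((extChartAt I (1 : G)).symm w)))
    (extChartAt I (1 : G) 1)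

/-- The adjoint action of `g`, read in the preferred chart at `1`. -/
noncomputable def chartAd (g : G) : E →L[ℝ] E :=
  chartDeriv I fun x => g * x * g⁻¹

/-- The multiplication, read in the preferred chart at `1`. -/
noncomputable def chartMul (G : Type*) [TopologicalSpace G] [ChartedSpace M G] [Group G]
    (z : E × E) : E :=
  extChartAt I (1 : G) ((extChartAt I (1 : G)).symm z.1 * (extChartAt I (1 : G)).symm z.2)

section Basic

lemma contDiffAt_chart_comp {X : Type*} [NormedAddCommGroup X] [NormedSpace ℝ X]
    {F : X → G} {x₀ : X} (hF : ContMDiffAt 𝓘(ℝ, X) I ∞ F x₀) (h1 : F x₀ = 1) :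
    ContDiffAt ℝ ∞ (fun x => extChartAt I (1 : G) (F x)) x₀ := by
  have h : ContMDiffAt I 𝓘(ℝ, E) ∞ (extChartAt I (1 : G)) (F x₀) := h1 ▸ contMDiffAt_extChartAt
  exact (h.comp x₀ hF).contDiffAt

lemma eventually_chart_symm_chart {X : Type*} [TopologicalSpace X]
    {F : X → G} {x₀ : X} (hF : ContinuousAt F x₀) (h1 : F x₀ = 1) :
    ∀ᶠ x in 𝓝 x₀, (extChartAt I (1 : G)).symm (extChartAt I (1 : G) (F x)) = F x := by
  have h : (extChartAt I (1 : G)).source ∈ 𝓝 (F x₀) := h1 ▸ extChartAt_source_mem_nhds (1 : G)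
  filter_upwards [hF h] with x hx using (extChartAt I (1 : G)).left_inv hx

lemma chart_symm_base : (extChartAt I (1 : G)).symm (extChartAt I (1 : G) 1) = 1 :=
  extChartAt_to_inv (1 : G)

lemma eventually_chart_chart_symm [I.Boundaryless] :
    ∀ᶠ u in 𝓝 (extChartAt I (1 : G) 1),
      extChartAt I (1 : G) ((extChartAt I (1 : G)).symm u) = u := by
  filter_upwards [extChartAt_target_mem_nhds (I := I) (1 : G)] with u hu
    using (extChartAt I (1 : G)).right_inv hu

lemma chartDeriv_id [I.Boundaryless] : chartDeriv I (fun x : G => x) = ContinuousLinearMap.id ℝ E := by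
  rw [chartDeriv, Filter.EventuallyEq.fderiv_eq (f := fun u => u)
    (eventually_chart_chart_symm (G := G) I)]
  exact fderiv_id

lemma chartAd_one [I.Boundaryless] : chartAd I (1 : G) = ContinuousLinearMap.id ℝ E := by
  rw [← chartDeriv_id (G := G) I, chartAd]
  simp

lemma contMDiff_conj [LieGroup I ∞ G] (g : G) : ContMDiff I I ∞ fun x : G => g * x * g⁻¹ :=
  (contMDiff_const.mul contMDiff_id).mul contMDiff_const


variable [I.Boundaryless] [LieGroup I ∞ G]

lemma contMDiffAt_chart_symm :
    ContMDiffAt 𝓘(ℝ, E) I ∞ (extChartAt I (1 : G)).symm (extChartAt I (1 : G) 1) :=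
  (contMDiffOn_extChartAt_symm (1 : G)).contMDiffAt (extChartAt_target_mem_nhds (1 : G))

lemma contMDiffAt_chart_symm_comp {X : Type*} [NormedAddCommGroup X] [NormedSpace ℝ X]
    (L : X → E) {x₀ : X} (hx : L x₀ = extChartAt I (1 : G) 1) (hL : ContDiff ℝ ∞ L) :
    ContMDiffAt 𝓘(ℝ, X) I ∞ (fun x => (extChartAt I (1 : G)).symm (L x)) x₀ := by
  have h : ContMDiffAt 𝓘(ℝ, E) I ∞ (extChartAt I (1 : G)).symm (L x₀) :=
    hx ▸ contMDiffAt_chart_symm I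
  exact h.comp x₀ hL.contMDiff.contMDiffAt

/-- Chain rule: the differential of `J ∘ F` in the chart. -/
lemma fderiv_chart_comp {X : Type*} [NormedAddCommGroup X] [NormedSpace ℝ X]
    {F : X → G} {x₀ : X} (hF : ContMDiffAt 𝓘(ℝ, X) I ∞ F x₀) (h1 : F x₀ = 1)
    {J : G → G} (hJ : ContMDiffAt I I ∞ J 1) (hJ1 : J 1 = 1) :
    fderiv ℝ (fun x => extChartAt I (1 : G) (J (F x))) x₀ =
      chartDeriv I J ∘L fderiv ℝ (fun x => extChartAt I (1 : G) (F x)) x₀ := by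
  have hJ' : ContDiffAt ℝ ∞ (fun w => extChartAt I (1 : G) (J ((extChartAt I (1 : G)).symm w)))
      (extChartAt I (1 : G) (F x₀)) := by
    rw [h1]
    refine contDiffAt_chart_comp I (ContMDiffAt.comp _ (I' := I) (g := J) ?_
      (contMDiffAt_chart_symm I)) ?_
    · rwa [chart_symm_base]
    · simp [hJ1]
  have hF' := contDiffAt_chart_comp I hF h1
  have key := fderiv_comp x₀ (hJ'.differentiableAt (by simp)) (hF'.differentiableAt (by simp))
  rw [h1] at key
  rw [chartDeriv, ← key]
  apply Filter.EventuallyEq.fderiv_eq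
  filter_upwards [eventually_chart_symm_chart I hF.continuousAt h1] with x hx
  simp only [Function.comp_apply, hx]

lemma fderiv_chart_conj {X : Type*} [NormedAddCommGroup X] [NormedSpace ℝ X]
    {F : X → G} {x₀ : X} (hF : ContMDiffAt 𝓘(ℝ, X) I ∞ F x₀) (h1 : F x₀ = 1) (g : G) :
    fderiv ℝ (fun x => extChartAt I (1 : G) (g * F x * g⁻¹)) x₀ =
      chartAd I g ∘L fderiv ℝ (fun x => extChartAt I (1 : G) (F x)) x₀ :=
  fderiv_chart_comp I hF h1 (J := fun x => g * x * g⁻¹) (contMDiff_conj I g).contMDiffAt (by simp)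

lemma chartAd_mul (g h : G) : chartAd I (g * h) = chartAd I g ∘L chartAd I h := by
  have hF := contMDiffAt_chart_symm (G := G) I
  have h1 := fderiv_chart_conj I (F := fun w => h * (extChartAt I (1 : G)).symm w * h⁻¹)
    (x₀ := extChartAt I (1 : G) 1) ((contMDiffAt_const.mul hF).mul contMDiffAt_const) (by simp) g
  unfold chartAd at *
  unfold chartDeriv at *
  rw [← h1]
  congr 1
  ext w
  simp [mul_assoc]

lemma contDiffAt_chartMul :
    ContDiffAt ℝ ∞ (chartMul I G) (extChartAt I (1 : G) 1, extChartAt I (1 : G) 1) := by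
  refine contDiffAt_chart_comp I (F := fun z : E × E => (extChartAt I (1 : G)).symm z.1 *
    (extChartAt I (1 : G)).symm z.2) (.mul ?_ ?_) (by simp)
  · exact contMDiffAt_chart_symm_comp I _ rfl contDiff_fst
  · exact contMDiffAt_chart_symm_comp I _ rfl contDiff_snd

/-- On each axis through the base point the multiplication is the identity, which determines both
partial derivatives. -/
lemma fderiv_chartMul :
    fderiv ℝ (chartMul I G) (extChartAt I (1 : G) 1, extChartAt I (1 : G) 1) =
      ContinuousLinearMap.fst ℝ E E + ContinuousLinearMap.snd ℝ E E := by
  have hd := (contDiffAt_chartMul (G := G) I).differentiableAt (by simp)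
  set p := extChartAt I (1 : G) 1 with hp
  have h1 : fderiv ℝ (fun u => chartMul I G (u, p)) p = ContinuousLinearMap.id ℝ E := by
    rw [Filter.EventuallyEq.fderiv_eq (f := fun u => u)]
    · exact fderiv_id
    · filter_upwards [eventually_chart_chart_symm (G := G) I] with u hu
      simp only [chartMul, hp, chart_symm_base, mul_one, hu]
  have h2 : fderiv ℝ (fun u => chartMul I G (p, u)) p = ContinuousLinearMap.id ℝ E := by
    rw [Filter.EventuallyEq.fderiv_eq (f := fun u => u)]
    · exact fderiv_id
    · filter_upwards [eventually_chart_chart_symm (G := G) I] with u hu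
      simp only [chartMul, hp, chart_symm_base, one_mul, hu]
  have e1 := HasFDerivAt.comp (g := chartMul I G) (f := fun u => (u, p)) p hd.hasFDerivAt
    (hasFDerivAt_prodMk_left p p)
  have e2 := HasFDerivAt.comp (g := chartMul I G) (f := fun u => (p, u)) p hd.hasFDerivAt
    (hasFDerivAt_prodMk_right p p)
  have e1 := e1.fderiv.symm.trans h1
  have e2 := e2.fderiv.symm.trans h2
  ext w
  · simpa using DFunLike.congr_fun e1 w
  · simpa using DFunLike.congr_fun e2 w

/-- The differential of a pointwise product of maps into a Lie group taking the value `1`. -/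
lemma fderiv_chart_mul {X : Type*} [NormedAddCommGroup X] [NormedSpace ℝ X]
    {F F' : X → G} {x₀ : X} (hF : ContMDiffAt 𝓘(ℝ, X) I ∞ F x₀) (h1 : F x₀ = 1)
    (hF' : ContMDiffAt 𝓘(ℝ, X) I ∞ F' x₀) (h1' : F' x₀ = 1) :
    fderiv ℝ (fun x => extChartAt I (1 : G) (F x * F' x)) x₀ =
      fderiv ℝ (fun x => extChartAt I (1 : G) (F x)) x₀ +
      fderiv ℝ (fun x => extChartAt I (1 : G) (F' x)) x₀ := by
  have d1 := ((contDiffAt_chart_comp I hF h1).differentiableAt (by simp)).hasFDerivAt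
  have d2 := ((contDiffAt_chart_comp I hF' h1').differentiableAt (by simp)).hasFDerivAt
  have d := ((contDiffAt_chartMul (G := G) I).differentiableAt (by simp)).hasFDerivAt
  rw [fderiv_chartMul] at d
  have d' : HasFDerivAt (chartMul I G)
      (ContinuousLinearMap.fst ℝ E E + ContinuousLinearMap.snd ℝ E E)
      (extChartAt I (1 : G) (F x₀), extChartAt I (1 : G) (F' x₀)) := by rwa [h1, h1']
  have key := (d'.comp x₀ (d1.prodMk d2)).fderiv
  rw [Filter.EventuallyEq.fderiv_eq (f := chartMul I G ∘ fun x =>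
    (extChartAt I (1 : G) (F x), extChartAt I (1 : G) (F' x))), key]
  · ext w; simp
  · filter_upwards [eventually_chart_symm_chart I hF.continuousAt h1,
      eventually_chart_symm_chart I hF'.continuousAt h1'] with x hx hx'
    simp only [Function.comp_apply, chartMul, hx, hx']

lemma fderiv_chart_inv {X : Type*} [NormedAddCommGroup X] [NormedSpace ℝ X]
    {F : X → G} {x₀ : X} (hF : ContMDiffAt 𝓘(ℝ, X) I ∞ F x₀) (h1 : F x₀ = 1) :
    fderiv ℝ (fun x => extChartAt I (1 : G) (F x)⁻¹) x₀ =
      -fderiv ℝ (fun x => extChartAt I (1 : G) (F x)) x₀ := by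
  have h := fderiv_chart_mul I hF.inv (by simp [h1]) hF h1
  simp only [inv_mul_cancel, fderiv_fun_const] at h
  exact eq_neg_of_add_eq_zero_left h.symm

/-- The differential of `x ↦ F x * g * (F x)⁻¹ * g⁻¹`, where `F x₀ = 1`, is `(1 - Ad g) ∘ dF`. -/
lemma fderiv_chart_commutator {X : Type*} [NormedAddCommGroup X] [NormedSpace ℝ X]
    {F : X → G} {x₀ : X} (hF : ContMDiffAt 𝓘(ℝ, X) I ∞ F x₀) (h1 : F x₀ = 1) (g : G) :
    fderiv ℝ (fun x => extChartAt I (1 : G) (F x * (g * (F x)⁻¹ * g⁻¹))) x₀ =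
      (ContinuousLinearMap.id ℝ E - chartAd I g) ∘L
        fderiv ℝ (fun x => extChartAt I (1 : G) (F x)) x₀ := by
  rw [fderiv_chart_mul I (F' := fun x => g * (F x)⁻¹ * g⁻¹) hF h1
    ((contMDiffAt_const.mul hF.inv).mul contMDiffAt_const) (by simp [h1]), fderiv_chart_conj I hF.inv (by simp [h1]), fderiv_chart_inv I hF h1]
  ext w
  simp [sub_eq_add_neg]

/-- The differential of a product of a list of maps into a Lie group taking the value `1`. -/
lemma fderiv_chart_list_prod {X : Type*} [NormedAddCommGroup X] [NormedSpace ℝ X] {x₀ : X}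
    (l : List (X → G)) (hl : ∀ F ∈ l, ContMDiffAt 𝓘(ℝ, X) I ∞ F x₀ ∧ F x₀ = 1) :
    ContMDiffAt 𝓘(ℝ, X) I ∞ (fun x => (l.map fun F => F x).prod) x₀ ∧
      (l.map fun F => F x₀).prod = 1 ∧
      fderiv ℝ (fun x => extChartAt I (1 : G) (l.map fun F => F x).prod) x₀ =
        (l.map fun F => fderiv ℝ (fun x => extChartAt I (1 : G) (F x)) x₀).sum := by
  induction l with
  | nil => simp [contMDiffAt_const]
  | cons F l ih =>
    obtain ⟨a, b, c⟩ := ih fun F' hF' => hl F' (List.mem_cons_of_mem _ hF')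
    obtain ⟨d, e⟩ := hl F List.mem_cons_self
    simp only [List.map_cons, List.prod_cons, List.sum_cons]
    exact ⟨d.mul a, by simp [e, b], by rw [fderiv_chart_mul I d e a b, c]⟩

end Basic

end LieGroupChart

/-! ### Second-order calculus: the derivative of `Ad` is the Lie bracket. -/

namespace LieGroupChart

section SecondOrder

variable {E : Type*} [NormedAddCommGroup E] [NormedSpace ℝ E]
  {M : Type*} [TopologicalSpace M] (I : ModelWithCorners ℝ E M)
  (G : Type*) [TopologicalSpace G] [ChartedSpace M G] [Group G]

/-- The second-order part `(v, w) ↦ ∂₁∂₂ m (v, w)` of the multiplication read in the chart. -/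
noncomputable def chartMulSnd (v w : E) : E :=
  fderiv ℝ (fderiv ℝ (chartMul I G)) (extChartAt I (1 : G) 1, extChartAt I (1 : G) 1) (v, 0) (0, w)

/-- The differential of left translations read in the chart. -/
noncomputable def chartLeft (u : E) : E →L[ℝ] E :=
  fderiv ℝ (chartMul I G) (u, extChartAt I (1 : G) 1) ∘L ContinuousLinearMap.inr ℝ E E

/-- The differential of right translations read in the chart. -/
noncomputable def chartRight (u : E) : E →L[ℝ] E :=
  fderiv ℝ (chartMul I G) (extChartAt I (1 : G) 1, u) ∘L ContinuousLinearMap.inl ℝ E E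

/-- The conjugation `(u, w) ↦ u w u⁻¹`, read in the chart. -/
noncomputable def chartConj (z : E × E) : E :=
  extChartAt I (1 : G) ((extChartAt I (1 : G)).symm z.1 * (extChartAt I (1 : G)).symm z.2 *
    ((extChartAt I (1 : G)).symm z.1)⁻¹)

variable [I.Boundaryless] [LieGroup I ∞ G]

lemma differentiableAt_fderiv_chartMul :
    DifferentiableAt ℝ (fderiv ℝ (chartMul I G))
      (extChartAt I (1 : G) 1, extChartAt I (1 : G) 1) :=
  ((contDiffAt_chartMul (G := G) I).fderiv_right (m := 1) (by norm_cast)).differentiableAt (by simp)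

lemma hasFDerivAt_chartLeft :
    HasFDerivAt (chartLeft I G)
      ((ContinuousLinearMap.compL ℝ E (E × E) E).flip (ContinuousLinearMap.inr ℝ E E) ∘L
        fderiv ℝ (fderiv ℝ (chartMul I G)) (extChartAt I (1 : G) 1, extChartAt I (1 : G) 1) ∘L
        ContinuousLinearMap.inl ℝ E E) (extChartAt I (1 : G) 1) := by
  have h := HasFDerivAt.comp (g := fderiv ℝ (chartMul I G))
    (f := fun u => (u, extChartAt I (1 : G) 1)) (extChartAt I (1 : G) 1)
    (differentiableAt_fderiv_chartMul I G).hasFDerivAt (hasFDerivAt_prodMk_left _ _)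
  exact ((ContinuousLinearMap.compL ℝ E (E × E) E).flip
    (ContinuousLinearMap.inr ℝ E E)).hasFDerivAt.comp _ h

lemma hasFDerivAt_chartRight :
    HasFDerivAt (chartRight I G)
      ((ContinuousLinearMap.compL ℝ E (E × E) E).flip (ContinuousLinearMap.inl ℝ E E) ∘L
        fderiv ℝ (fderiv ℝ (chartMul I G)) (extChartAt I (1 : G) 1, extChartAt I (1 : G) 1) ∘L
        ContinuousLinearMap.inr ℝ E E) (extChartAt I (1 : G) 1) := by
  have h := HasFDerivAt.comp (g := fderiv ℝ (chartMul I G))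
    (f := fun u => (extChartAt I (1 : G) 1, u)) (extChartAt I (1 : G) 1)
    (differentiableAt_fderiv_chartMul I G).hasFDerivAt (hasFDerivAt_prodMk_right _ _)
  exact ((ContinuousLinearMap.compL ℝ E (E × E) E).flip
    (ContinuousLinearMap.inl ℝ E E)).hasFDerivAt.comp _ h

lemma chartLeft_base : chartLeft I G (extChartAt I (1 : G) 1) = ContinuousLinearMap.id ℝ E := by
  rw [chartLeft, fderiv_chartMul]; ext w; simp

lemma chartRight_base : chartRight I G (extChartAt I (1 : G) 1) = ContinuousLinearMap.id ℝ E := by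
  rw [chartRight, fderiv_chartMul]; ext w; simp

lemma fderiv_chartLeft_apply (v w : E) :
    fderiv ℝ (chartLeft I G) (extChartAt I (1 : G) 1) v w = chartMulSnd I G v w := by
  rw [(hasFDerivAt_chartLeft I G).fderiv]
  simp [chartMulSnd]

/-- Symmetry of the second derivative lets left and right translations share one bilinear form, with
arguments exchanged. -/
lemma fderiv_chartRight_apply (v w : E) :
    fderiv ℝ (chartRight I G) (extChartAt I (1 : G) 1) v w = chartMulSnd I G w v := by
  rw [(hasFDerivAt_chartRight I G).fderiv]
  have := (contDiffAt_chartMul (G := G) I).isSymmSndFDerivAt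
    (by rw [minSmoothness_of_isRCLikeNormedField]; norm_cast) (w, 0) (0, v)
  simp only [chartMulSnd, this]
  simp

lemma contMDiffAt_conj_chart_symm :
    ContMDiffAt 𝓘(ℝ, E × E) I ∞ (fun z : E × E => (extChartAt I (1 : G)).symm z.1 *
      (extChartAt I (1 : G)).symm z.2 * ((extChartAt I (1 : G)).symm z.1)⁻¹)
      (extChartAt I (1 : G) 1, extChartAt I (1 : G) 1) := by
  have h1 := contMDiffAt_chart_symm_comp (G := G) I (Prod.fst : E × E → E)
    (x₀ := (extChartAt I (1 : G) 1, extChartAt I (1 : G) 1)) rfl contDiff_fst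
  have h2 := contMDiffAt_chart_symm_comp (G := G) I (Prod.snd : E × E → E)
    (x₀ := (extChartAt I (1 : G) 1, extChartAt I (1 : G) 1)) rfl contDiff_snd
  exact (h1.mul h2).mul h1.inv

lemma contDiffAt_chartConj :
    ContDiffAt ℝ ∞ (chartConj I G) (extChartAt I (1 : G) 1, extChartAt I (1 : G) 1) :=
  contDiffAt_chart_comp I (contMDiffAt_conj_chart_symm I G) (by simp)

/-- `Ad` is a partial derivative of the smooth conjugation map. Being `C¹` supplies the strict
differentiability on which the two-point estimate rests. -/
lemma contDiffAt_chartAd :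
    ContDiffAt ℝ 1 (fun u => chartAd I ((extChartAt I (1 : G)).symm u))
      (extChartAt I (1 : G) 1) :=
  ContDiffAt.fderiv (f := fun u w => chartConj I G (u, w)) (g := fun _ => extChartAt I (1 : G) 1)
    (n := ∞) (contDiffAt_chartConj I G) contDiffAt_const (by norm_cast)

/-- Differentiate `u * w = (u * w * u⁻¹) * u` in `w` at `1`. -/
lemma eventually_chartLeft_eq :
    ∀ᶠ u in 𝓝 (extChartAt I (1 : G) 1),
      chartLeft I G u = chartRight I G u ∘L chartAd I ((extChartAt I (1 : G)).symm u) := by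
  have hdm : ∀ᶠ z in 𝓝 (extChartAt I (1 : G) 1, extChartAt I (1 : G) 1),
      DifferentiableAt ℝ (chartMul I G) z :=
    (((contDiffAt_chartMul (G := G) I).of_le (m := 1) (by norm_cast)).eventually (by simp)).mono
      fun z hz => hz.differentiableAt (by simp)
  have hdc : ∀ᶠ z in 𝓝 (extChartAt I (1 : G) 1, extChartAt I (1 : G) 1),
      DifferentiableAt ℝ (chartConj I G) z :=
    (((contDiffAt_chartConj I G).of_le (m := 1) (by norm_cast)).eventually (by simp)).mono
      fun z hz => hz.differentiableAt (by simp)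
  have hl : Continuous fun u : E => (u, extChartAt I (1 : G) 1) := by fun_prop
  have hr : Continuous fun u : E => (extChartAt I (1 : G) 1, u) := by fun_prop
  have heq := eventually_chart_symm_chart I (contMDiffAt_conj_chart_symm I G).continuousAt
    (by simp)
  rw [nhds_prod_eq] at heq
  -- Currying gives, for each fixed `u` near the base point, validity for all `w` near it, as
  -- differentiation in `w` requires.
  filter_upwards [heq.curry, hl.continuousAt.eventually hdm, hr.continuousAt.eventually hdm,
    hl.continuousAt.eventually hdc] with u hu h1 h2 h3
  have hbase : chartConj I G (u, extChartAt I (1 : G) 1) = extChartAt I (1 : G) 1 := by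
    simp only [chartConj, chart_symm_base, mul_one, mul_inv_cancel]
  have hA : HasFDerivAt (fun w => chartConj I G (u, w))
      (chartAd I ((extChartAt I (1 : G)).symm u)) (extChartAt I (1 : G) 1) :=
    DifferentiableAt.hasFDerivAt (f := fun w => chartConj I G (u, w))
      (h3.comp (extChartAt I (1 : G) 1) (hasFDerivAt_prodMk_right u _).differentiableAt)
  have hL : HasFDerivAt (fun w => chartMul I G (u, w)) (chartLeft I G u)
      (extChartAt I (1 : G) 1) :=
    HasFDerivAt.comp (g := chartMul I G) (f := fun w => (u, w)) _ h1.hasFDerivAt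
      (hasFDerivAt_prodMk_right u _)
  have hR : HasFDerivAt (fun w => chartMul I G (w, u)) (chartRight I G u)
      (chartConj I G (u, extChartAt I (1 : G) 1)) := by
    rw [hbase]
    exact HasFDerivAt.comp (g := chartMul I G) (f := fun w => (w, u)) _ h2.hasFDerivAt
      (hasFDerivAt_prodMk_left _ u)
  refine hL.unique ((HasFDerivAt.comp (g := fun w => chartMul I G (w, u))
    (f := fun w => chartConj I G (u, w)) _ hR hA).congr_of_eventuallyEq ?_)
  filter_upwards [hu] with w hw
  simp only [Function.comp_apply, chartMul, chartConj] at hw ⊢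
  rw [hw, inv_mul_cancel_right]

/-- The differential of the adjoint representation is the antisymmetrization of the second-order
part of the multiplication. -/
lemma fderiv_chartAd_apply (v w : E) :
    fderiv ℝ (fun u => chartAd I ((extChartAt I (1 : G)).symm u)) (extChartAt I (1 : G) 1) v w =
      chartMulSnd I G v w - chartMulSnd I G w v := by
  have hA := ((contDiffAt_chartAd I G).differentiableAt (by simp)).hasFDerivAt
  have hR := (hasFDerivAt_chartRight I G).differentiableAt.hasFDerivAt
  -- Product rule for `chartLeft = chartRight ∘ Ad`: both factors are the identity at the base
  -- point, so the derivatives add.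
  have h := (hR.clm_comp hA).congr_of_eventuallyEq (eventually_chartLeft_eq I G)
  have h' := DFunLike.congr_fun (DFunLike.congr_fun h.fderiv v) w
  rw [fderiv_chartLeft_apply] at h'
  simp only [add_apply, ContinuousLinearMap.comp_apply,
    ContinuousLinearMap.compL_apply, ContinuousLinearMap.flip_apply, chartRight_base,
    chart_symm_base, chartAd_one, ContinuousLinearMap.id_apply, fderiv_chartRight_apply] at h'
  rw [h', add_sub_cancel_right]

/-- Left invariant vector fields read in the chart. -/
lemma eventually_mpullbackWithin_mulInvariantVectorField (v : GroupLieAlgebra I G) :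
    ∀ᶠ z in 𝓝 (extChartAt I (1 : G) 1),
      VectorField.mpullbackWithin 𝓘(ℝ, E) I (extChartAt I (1 : G)).symm
        (mulInvariantVectorField v) (Set.range I) z = chartLeft I G z v := by
  have hdm : ∀ᶠ z in 𝓝 (extChartAt I (1 : G) 1, extChartAt I (1 : G) 1),
      DifferentiableAt ℝ (chartMul I G) z :=
    (((contDiffAt_chartMul (G := G) I).of_le (m := 1) (by norm_cast)).eventually (by simp)).mono
      fun z hz => hz.differentiableAt (by simp)
  have hl : Continuous fun u : E => (u, extChartAt I (1 : G) 1) := by fun_prop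
  filter_upwards [hl.continuousAt.eventually hdm,
    extChartAt_target_mem_nhds (I := I) (1 : G)] with z h1 hz
  have hL : HasFDerivAt (fun w => chartMul I G (z, w)) (chartLeft I G z)
      (extChartAt I (1 : G) 1) :=
    HasFDerivAt.comp (g := chartMul I G) (f := fun w => (z, w)) _ h1.hasFDerivAt
      (hasFDerivAt_prodMk_right z _)
  -- Pulling back along the inverse chart amounts to applying the differential of the chart; the
  -- chain rule then identifies the result with `chartLeft`.
  have hinv := ContinuousLinearMap.inverse_eq
    (mfderivWithin_extChartAt_symm_comp_mfderiv_extChartAt (I := I) hz)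
    (mfderiv_extChartAt_comp_mfderivWithin_extChartAt_symm (I := I) hz)
  have hz' : (extChartAt I (1 : G)).symm z ∈ (extChartAt I (1 : G)).source :=
    (extChartAt I (1 : G)).map_target hz
  have hφ : MDifferentiableAt I 𝓘(ℝ, E) (extChartAt I (1 : G)) ((extChartAt I (1 : G)).symm z) :=
    mdifferentiableAt_extChartAt (by simpa using hz')
  have hmul : MDifferentiable I I fun x : G => (extChartAt I (1 : G)).symm z * x :=
    (contMDiff_mul_left (I := I) (n := ∞)).mdifferentiable (by simp)
  have hs : MDifferentiableAt 𝓘(ℝ, E) I (extChartAt I (1 : G)).symm (extChartAt I (1 : G) 1) :=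
    (contMDiffAt_chart_symm I).mdifferentiableAt (by simp)
  have hs' := mfderivWithin_range_extChartAt_symm (I := I) (x := (1 : G))
  rw [I.range_eq_univ, mfderivWithin_univ] at hs'
  have e1 := mfderiv_comp_apply_of_eq (I' := I) (extChartAt I (1 : G) 1) (hmul 1) hs
    (chart_symm_base I) v
  have hcomp := MDifferentiableAt.comp_of_eq (extChartAt I (1 : G) 1) (hmul 1) hs (chart_symm_base I)
  have e2 := mfderiv_comp_apply_of_eq (I' := I) (I'' := 𝓘(ℝ, E)) (extChartAt I (1 : G) 1) hφ
    hcomp (by simp) v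
  rw [e1, hs'] at e2
  rw [VectorField.mpullbackWithin_apply, hinv, ← hL.fderiv, ← mfderiv_eq_fderiv]
  exact e2.symm

/-- In the chart the left-invariant fields are `z ↦ chartLeft I G z v`, whose first derivative at
the base point is `chartMulSnd`. With `fderiv_chartAd_apply` this identifies the derivative of `Ad`
with the bracket. -/
lemma bracket_eq_chartMulSnd (v w : GroupLieAlgebra I G) :
    (⁅v, w⁆ : GroupLieAlgebra I G) = chartMulSnd I G v w - chartMulSnd I G w v := by
  let D : E →L[ℝ] E := mfderiv I 𝓘(ℝ, E) (extChartAt I (1 : G)) 1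
  have hD : D = ContinuousLinearMap.id ℝ E := mfderiv_extChartAt_self
  have hid : D.inverse = ContinuousLinearMap.id ℝ E := by
    rw [hD, ContinuousLinearMap.inverse_id]
  rw [GroupLieAlgebra.bracket_def]
  refine (DFunLike.congr_fun hid _).trans ?_
  rw [ContinuousLinearMap.id_apply, I.range_eq_univ, Set.preimage_univ, Set.univ_inter]
  refine (congrFun VectorField.lieBracketWithin_univ _).trans ?_
  have hv := eventually_mpullbackWithin_mulInvariantVectorField I G v
  have hw := eventually_mpullbackWithin_mulInvariantVectorField I G w
  rw [I.range_eq_univ] at hv hw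
  have hd := (hasFDerivAt_chartLeft I G).differentiableAt
  have key (v w : E) : fderiv ℝ (fun z => chartLeft I G z w) (extChartAt I (1 : G) 1) v =
      chartMulSnd I G v w := by
    rw [← fderiv_chartLeft_apply, fderiv_clm_apply hd (by fun_prop)]
    simp
  have hbr (v w : E) : VectorField.lieBracket ℝ (fun z => chartLeft I G z v)
      (fun z => chartLeft I G z w) (extChartAt I (1 : G) 1) =
      chartMulSnd I G v w - chartMulSnd I G w v := by
    rw [VectorField.lieBracket, key, key, chartLeft_base]
    rfl
  exact (Filter.EventuallyEq.lieBracket_vectorField_eq (V := fun z => chartLeft I G z v)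
    (W := fun z => chartLeft I G z w) hv hw).trans (hbr v w)

end SecondOrder

end LieGroupChart

/-! ### Stability of joint surjectivity for families of operators. -/

section FunctionalAnalysis

/-- Surjectivity of `w ↦ ∑ i, B i (w i)` is an open condition on the family `B`. -/
lemma eventually_surjective_sum {ι E : Type*} [Fintype ι] [NormedAddCommGroup E]
    [NormedSpace ℝ E] [FiniteDimensional ℝ E] (B₀ : ι → E →L[ℝ] E)
    (h : ∀ z, ∃ w : ι → E, ∑ i, B₀ i (w i) = z) :
    ∀ᶠ B in 𝓝 B₀, ∀ z, ∃ w : ι → E, ∑ i, B i (w i) = z := by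
  have : CompleteSpace E := FiniteDimensional.complete ℝ E
  let Λ : (ι → E) →L[ℝ] E := ∑ i, B₀ i ∘L ContinuousLinearMap.proj i
  have hΛ : Function.Surjective (Λ : (ι → E) →ₗ[ℝ] E) := fun z => by
    obtain ⟨w, hw⟩ := h z
    exact ⟨w, by simpa [Λ] using hw⟩
  -- Composing with a right inverse of the sum map for `B₀` gives the identity at `B₀`, hence a unit
  -- for nearby `B`.
  obtain ⟨S, hS⟩ := (Λ : (ι → E) →ₗ[ℝ] E).exists_rightInverse_of_surjective
    (LinearMap.range_eq_top.2 hΛ)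
  let S' : ι → E →L[ℝ] E := fun i => ContinuousLinearMap.proj i ∘L S.toContinuousLinearMap
  have hc : Continuous fun B : ι → E →L[ℝ] E => ∑ i, B i ∘L S' i := by fun_prop
  have h1 : ∑ i, B₀ i ∘L S' i = 1 := by
    ext z
    have := LinearMap.congr_fun hS z
    simpa [Λ, S'] using this
  have hu : ∀ᶠ B in 𝓝 B₀, IsUnit (∑ i, B i ∘L S' i) :=
    by
    refine hc.continuousAt.eventually (Units.isOpen.mem_nhds ?_)
    change IsUnit (∑ i, B₀ i ∘L S' i)
    rw [h1]
    exact isUnit_one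
  filter_upwards [hu] with B ⟨u, hu⟩ z
  refine ⟨fun i => S' i ((↑u⁻¹ : E →L[ℝ] E) z), ?_⟩
  have := DFunLike.congr_fun (u.mul_inv) z
  rw [hu] at this
  simpa using this

/-- Along lines in the directions `y i`, difference quotients with small distinct parameters of
a strictly differentiable family of operators keep the surjectivity of `w ↦ ∑ i, A' (y i) (w i)`. -/
lemma HasStrictFDerivAt.eventually_surjective_sum_sub {ι E : Type*} [Fintype ι]
    [NormedAddCommGroup E] [NormedSpace ℝ E] [FiniteDimensional ℝ E]
    {A : E → E →L[ℝ] E} {A' : E →L[ℝ] E →L[ℝ] E} {p : E} (hA : HasStrictFDerivAt A A' p)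
    (y : ι → E) (h : ∀ z, ∃ w : ι → E, ∑ i, A' (y i) (w i) = z) :
    ∃ ε > 0, ∀ s t : ι → ℝ, (∀ i, |s i| < ε) → (∀ i, |t i| < ε) → (∀ i, s i ≠ t i) →
      ∀ z, ∃ w : ι → E, ∑ i, (A (p + s i • y i) - A (p + t i • y i)) (w i) = z := by
  obtain ⟨δ, hδ, hB⟩ := Metric.eventually_nhds_iff.1
    (eventually_surjective_sum (fun i => A' (y i)) h)
  -- Both parameters vary freely, so the estimate uses strict differentiability rather than
  -- differentiability at `p`.
  have key (i : ι) : ∀ᶠ q : ℝ × ℝ in 𝓝 (0, 0),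
      ‖A (p + q.1 • y i) - A (p + q.2 • y i) - (q.1 - q.2) • A' (y i)‖ ≤
        δ / 2 * ‖q.1 - q.2‖ := by
    have hl : HasStrictFDerivAt (fun s : ℝ => p + s • y i)
        ((1 : ℝ →L[ℝ] ℝ).smulRight (y i)) 0 :=
      ((1 : ℝ →L[ℝ] ℝ).smulRight (y i)).hasStrictFDerivAt.const_add p
    have hA0 : HasStrictFDerivAt A A' (p + (0 : ℝ) • y i) := by simpa using hA
    have := (HasStrictFDerivAt.comp (g := A) (f := fun s : ℝ => p + s • y i) (0 : ℝ) hA0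
      hl).isLittleO.bound (half_pos hδ)
    simpa using this
  obtain ⟨ε, hε, H⟩ := Metric.eventually_nhds_iff.1 (eventually_all.2 key)
  refine ⟨ε, hε, fun s t hs ht hst z => ?_⟩
  have hB' : dist (fun i => (s i - t i)⁻¹ • (A (p + s i • y i) - A (p + t i • y i)))
      (fun i => A' (y i)) < δ := by
    refine lt_of_le_of_lt ((dist_pi_le_iff (half_pos hδ).le).2 fun i => ?_) (half_lt_self hδ)
    have hne : s i - t i ≠ 0 := sub_ne_zero.2 (hst i)
    have hq : dist (s i, t i) ((0 : ℝ), (0 : ℝ)) < ε := by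
      simpa [Prod.dist_eq, Real.dist_eq] using ⟨hs i, ht i⟩
    have hb := H hq i
    rw [dist_eq_norm]
    have e : (s i - t i)⁻¹ • (A (p + s i • y i) - A (p + t i • y i)) - A' (y i) =
        (s i - t i)⁻¹ • (A (p + s i • y i) - A (p + t i • y i) - (s i - t i) • A' (y i)) := by
      rw [smul_sub _ _ ((s i - t i) • A' (y i)), inv_smul_smul₀ hne]
    rw [e, norm_smul, norm_inv, inv_mul_le_iff₀ (norm_pos_iff.2 hne), mul_comm]
    exact hb
  obtain ⟨w, hw⟩ := hB hB' z
  refine ⟨fun i => (s i - t i)⁻¹ • w i, ?_⟩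
  simpa using hw

/-- If the values of `b` span, so do the values of `b` on a basis in the first variable. -/
lemma exists_sum_basis_eq {ι E : Type*} [Fintype ι] [NormedAddCommGroup E]
    [NormedSpace ℝ E] (y : Module.Basis ι ℝ E) (b : E →L[ℝ] E →L[ℝ] E)
    (h : Submodule.span ℝ {z | ∃ v w, b v w = z} = ⊤) (z : E) :
    ∃ w : ι → E, ∑ i, b (y i) (w i) = z := by
  let Λ : (ι → E) →ₗ[ℝ] E := ∑ i, (b (y i) : E →ₗ[ℝ] E) ∘ₗ LinearMap.proj i
  have hle : Submodule.span ℝ {z | ∃ v w, b v w = z} ≤ LinearMap.range Λ := by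
    rw [Submodule.span_le]
    rintro _ ⟨v, w, rfl⟩
    refine ⟨fun i => y.repr v i • w, ?_⟩
    have := congrArg (fun u => b u w) (y.sum_repr v)
    simp only [map_sum, map_smul, sum_apply, smul_apply] at this
    simpa [Λ] using this
  obtain ⟨w, hw⟩ := hle (h ▸ Submodule.mem_top : z ∈ _)
  exact ⟨w, by simpa [Λ] using hw⟩

end FunctionalAnalysis

/-! ### Compactness arguments in topological groups. -/

section TopologicalGroups

variable {H : Type*} [Group H] [TopologicalSpace H] [IsTopologicalGroup H]

lemma exists_nhds_one_list_prod_mem (n : ℕ) {W : Set H} (hW : W ∈ 𝓝 (1 : H)) :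
    ∃ V ∈ 𝓝 (1 : H), ∀ l : List H, l.length = n → (∀ x ∈ l, x ∈ V) → l.prod ∈ W := by
  induction n generalizing W with
  | zero =>
    refine ⟨W, hW, fun l hl _ => ?_⟩
    rw [List.length_eq_zero_iff.1 hl]
    exact mem_of_mem_nhds hW
  | succ n ih =>
    obtain ⟨V, hV, hVW⟩ := exists_nhds_one_split hW
    obtain ⟨V', hV', h⟩ := ih hV
    refine ⟨V ∩ V', inter_mem hV hV', fun l hl hx => ?_⟩
    cases l with
    | nil => simp at hl
    | cons a l =>
      rw [List.prod_cons]
      exact hVW _ (hx a List.mem_cons_self).1 _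
        (h l (by simpa using hl) fun x hxl => (hx x (List.mem_cons_of_mem _ hxl)).2)

/-- Commutators of elements of a compact set with elements close to `1` are close to `1`. -/
lemma IsCompact.eventually_commutator_mem {K W : Set H} (hK : IsCompact K)
    (hW : W ∈ 𝓝 (1 : H)) : ∀ᶠ x in 𝓝 (1 : H), ∀ k ∈ K, k * (x * k⁻¹ * x⁻¹) ∈ W := by
  -- The commutator is trivial at `x = 1` for every `k`; compactness of `K` makes the neighbourhood
  -- uniform in `k`.
  refine hK.eventually_forall_of_forall_eventually fun k _ => ?_
  have hc : Continuous fun z : H × H => z.2 * (z.1 * z.2⁻¹ * z.1⁻¹) := by fun_prop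
  exact hc.continuousAt.eventually (by simpa using hW)

/-- Among infinitely many elements of a compact set two have a quotient close to `1`. -/
lemma IsCompact.exists_ne_div_mem {K W : Set H} (hK : IsCompact K) (hW : W ∈ 𝓝 (1 : H))
    {α : Type*} {S : Set α} (hS : S.Infinite) {f : α → H} (hf : ∀ s ∈ S, f s ∈ K) :
    ∃ s ∈ S, ∃ t ∈ S, s ≠ t ∧ f t * (f s)⁻¹ ∈ W := by
  obtain ⟨V, hV, hVW⟩ := exists_nhds_split_inv hW
  obtain ⟨T, hTK, hT⟩ := hK.elim_nhds_subcover (fun k => (fun x => x * k⁻¹) ⁻¹' V) fun k _ =>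
    (continuous_mul_const k⁻¹).continuousAt (by simpa using hV)
  have hex (s : S) : ∃ k ∈ T, f s * k⁻¹ ∈ V := by simpa using hT (hf s s.2)
  choose c hcT hc using hex
  have : Infinite S := hS.to_subtype
  -- Pigeonhole: two indices share a centre of the finite cover, which cancels in the quotient.
  obtain ⟨s, t, hst, e⟩ := Finite.exists_ne_map_eq_of_infinite fun s => (⟨c s, hcT s⟩ : T)
  have e' : c s = c t := congrArg Subtype.val e
  refine ⟨s, s.2, t, t.2, fun h => hst (Subtype.ext h), ?_⟩
  have := hVW _ (hc t) _ (hc s)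
  simpa [div_eq_mul_inv, e'] using this

/-- A homomorphism that is relatively compact on a spacious set is relatively compact on a
neighbourhood of `1`. -/
lemma IsSpacious.exists_nhds_one_map_subset {G : Type*} [Group G] [TopologicalSpace G]
    [IsTopologicalGroup G] (ψ : G →* H) {C : Set G} (hC : IsSpacious C) {K : Set H}
    (hK : IsCompact K) (hCK : ψ '' C ⊆ K) :
    ∃ V ∈ 𝓝 (1 : G), ∃ K' : Set H, IsCompact K' ∧ ∀ g ∈ V, ψ g ∈ K' := by
  have key (l : List G) : ∃ K' : Set H, IsCompact K' ∧
      ∀ g ∈ (l.map fun g => g • (C * C⁻¹)).prod, ψ g ∈ K' := by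
    induction l with
    | nil => exact ⟨{1}, isCompact_singleton, by simp⟩
    | cons a l ih =>
      obtain ⟨K', hK', h⟩ := ih
      refine ⟨({ψ a} * (K * K⁻¹)) * K', (isCompact_singleton.mul (hK.mul hK.inv)).mul hK', ?_⟩
      rw [List.map_cons, List.prod_cons]
      rintro _ ⟨_, ⟨_, ⟨c, hc, d, hd, rfl⟩, rfl⟩, g, hg, rfl⟩
      have hd' : (ψ d)⁻¹ ∈ K := by rw [← map_inv]; exact hCK ⟨_, hd, rfl⟩
      simp only [smul_eq_mul, map_mul]
      exact Set.mul_mem_mul (Set.mul_mem_mul rfl (Set.mul_mem_mul (hCK ⟨c, hc, rfl⟩)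
        (Set.mem_inv.2 hd'))) (h g hg)
  obtain ⟨l, -, q, hq⟩ := hC
  obtain ⟨K', hK', h⟩ := key l
  -- Translation moves the interior point `q` to `1`, at the cost of the factor `(ψ q)⁻¹`.
  refine ⟨(fun g => q * g) ⁻¹' (l.map fun g => g • (C * C⁻¹)).prod,
    (continuous_const_mul q).continuousAt (by simpa using mem_interior_iff_mem_nhds.1 hq),
    {(ψ q)⁻¹} * K', isCompact_singleton.mul hK', fun g hg => ?_⟩
  exact ⟨_, rfl, _, h _ hg, by simp⟩

end TopologicalGroups

/-! ### Products of commutators fill a neighbourhood of `1`. -/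

namespace LieGroupChart

variable {E : Type*} [NormedAddCommGroup E] [NormedSpace ℝ E] [FiniteDimensional ℝ E]
  {M : Type*} [TopologicalSpace M] (I : ModelWithCorners ℝ E M) [I.Boundaryless]
  {G : Type*} [TopologicalSpace G] [ChartedSpace M G] [Group G] [LieGroup I ∞ G]

/-- If the operators `1 - Ad (x i)` have jointly full range, products of commutators
`h i * x i * (h i)⁻¹ * (x i)⁻¹` with `h i` close to `1` fill a neighbourhood of `1`. -/
lemma eventually_exists_prod_commutator {n : ℕ} (x : Fin n → G)
    (hx : ∀ z : E, ∃ w : Fin n → E, ∑ i, (w i - chartAd I (x i) (w i)) = z)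
    {V : Set G} (hV : V ∈ 𝓝 (1 : G)) :
    ∀ᶠ g in 𝓝 (1 : G), ∃ h : Fin n → G, (∀ i, h i ∈ V) ∧
      (List.ofFn fun i => h i * (x i * (h i)⁻¹ * (x i)⁻¹)).prod = g := by
  have : CompleteSpace E := FiniteDimensional.complete ℝ E
  let P : Fin n → E := fun _ => extChartAt I (1 : G) 1
  let F : Fin n → (Fin n → E) → G := fun i u => (extChartAt I (1 : G)).symm (u i)
  have hF (i : Fin n) : ContMDiffAt 𝓘(ℝ, Fin n → E) I ∞ (F i) P :=
    contMDiffAt_chart_symm_comp I (fun u : Fin n → E => u i) rfl (contDiff_apply ℝ E i)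
  have hF1 (i : Fin n) : F i P = 1 := chart_symm_base I
  have hdF (i : Fin n) : fderiv ℝ (fun u => extChartAt I (1 : G) (F i u)) P =
      ContinuousLinearMap.proj i := by
    rw [Filter.EventuallyEq.fderiv_eq (f := fun u : Fin n → E => u i)]
    · exact (ContinuousLinearMap.proj (R := ℝ) (φ := fun _ : Fin n => E) i).fderiv
    · have hc : Tendsto (fun u : Fin n → E => u i) (𝓝 P) (𝓝 (extChartAt I (1 : G) 1)) :=
        (continuous_apply i).tendsto P
      exact hc.eventually (eventually_chart_chart_symm (G := G) I)
  let l : List ((Fin n → E) → G) :=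
    List.ofFn fun i u => F i u * (x i * (F i u)⁻¹ * (x i)⁻¹)
  obtain ⟨hΘ, hΘ1, hdΘ⟩ := fderiv_chart_list_prod I (x₀ := P) l fun f hf => by
    obtain ⟨i, rfl⟩ := List.mem_ofFn.1 hf
    exact ⟨(hF i).mul ((contMDiffAt_const.mul (hF i).inv).mul contMDiffAt_const), by simp [hF1]⟩
  have hs := (contDiffAt_chart_comp I hΘ hΘ1).hasStrictFDerivAt (by simp)
  have hsurj : (fderiv ℝ (fun u => extChartAt I (1 : G) (l.map fun f => f u).prod) P).range = ⊤ := by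
    rw [hdΘ, LinearMap.range_eq_top]
    intro z
    obtain ⟨w, hw⟩ := hx z
    refine ⟨w, ?_⟩
    rw [← hw]
    simp only [l, List.map_ofFn, List.sum_ofFn, Function.comp_def]
    rw [ContinuousLinearMap.coe_coe, sum_apply]
    refine Finset.sum_congr rfl fun i _ => ?_
    rw [fderiv_chart_commutator I (hF i) (hF1 i), hdF]
    simp
  -- A surjective strict derivative makes the product map open at `P`.
  have hmap := hs.map_nhds_eq_of_surj hsurj
  -- The chart is injective only on its source, so the product must stay there for equality in the
  -- chart to give equality in `G`.
  have hgood : ∀ᶠ u in 𝓝 P, (∀ i, F i u ∈ V) ∧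
      (l.map fun f => f u).prod ∈ (extChartAt I (1 : G)).source := by
    refine (eventually_all.2 fun i => (hF i).continuousAt (by rwa [hF1 i])).and
      (hΘ.continuousAt ?_)
    rw [hΘ1]
    exact extChartAt_source_mem_nhds (1 : G)
  have himage := image_mem_map (m := fun u => extChartAt I (1 : G) (l.map fun f => f u).prod) hgood
  rw [hmap, hΘ1] at himage
  filter_upwards [(continuousAt_extChartAt (I := I) (1 : G)) himage,
    extChartAt_source_mem_nhds (I := I) (1 : G)] with g ⟨u, ⟨hu, hus⟩, hug⟩ hg
  refine ⟨fun i => F i u, hu, ?_⟩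
  rw [← (extChartAt I (1 : G)).injOn hus hg hug]
  simp [l, List.map_ofFn, Function.comp_def]

end LieGroupChart

/-! ### The continuity theorem. -/

open LieGroupChart

theorem theoremD
    {E : Type*} [NormedAddCommGroup E] [NormedSpace ℝ E] [FiniteDimensional ℝ E]
    {M : Type*} [TopologicalSpace M] (I : ModelWithCorners ℝ E M) [I.Boundaryless]
    {G : Type*} [TopologicalSpace G] [ChartedSpace M G] [Group G] [LieGroup I ∞ G]
    (hG : HasPerfectLieAlgebra I G)
    {H : Type*} [Group H] [TopologicalSpace H] [IsTopologicalGroup H]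
    (ψ : G →* H)
    (hC : ∃ C : Set G, IsCompact C ∧ IsSpacious C ∧ IsCompact (closure (ψ '' C))) :
    Continuous ψ := by
  have : IsTopologicalGroup G := topologicalGroup_of_lieGroup I ∞
  obtain ⟨C, -, hC, hK⟩ := hC
  obtain ⟨V, hV, K, hK, hVK⟩ := hC.exists_nhds_one_map_subset ψ hK subset_closure
  refine continuous_of_continuousAt_one ψ fun W hW => ?_
  rw [map_one] at hW
  set φ := extChartAt I (1 : G) with hφ
  have hA := (contDiffAt_chartAd I G).hasStrictFDerivAt (by simp)
  let y := Module.finBasis ℝ E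
  have hspan := exists_sum_basis_eq y _ (by
    have : {z | ∃ v w, fderiv ℝ (fun u => chartAd I (φ.symm u)) (φ 1) v w = z} =
        {z : GroupLieAlgebra I G | ∃ v w : GroupLieAlgebra I G, ⁅v, w⁆ = z} := by
      simp only [fderiv_chartAd_apply, hφ, bracket_eq_chartMulSnd]
      rfl
    rw [this]
    exact hG)
  obtain ⟨ε, hε, hsurj⟩ := hA.eventually_surjective_sum_sub y hspan
  -- One commutator is used per basis vector.
  obtain ⟨W₁, hW₁, hprod⟩ := exists_nhds_one_list_prod_mem (Module.finrank ℝ E) hW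
  have hW₂ := hK.eventually_commutator_mem hW₁
  have hpair (i) : ∃ s t : ℝ, |s| < ε ∧ |t| < ε ∧ s ≠ t ∧
      ψ (φ.symm (φ 1 + t • y i) * (φ.symm (φ 1 + s • y i))⁻¹) ∈
        {x | ∀ k ∈ K, k * (x * k⁻¹ * x⁻¹) ∈ W₁} := by
    have hc : ContinuousAt (fun s : ℝ => φ.symm (φ 1 + s • y i)) 0 := by
      have h1 : ContinuousAt φ.symm (φ 1 + (0 : ℝ) • y i) := by
        rw [zero_smul, add_zero]
        exact (contMDiffAt_chart_symm (G := G) I).continuousAt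
      exact h1.comp (f := fun s : ℝ => φ 1 + s • y i) (by fun_prop)
    have hV' : ∀ᶠ s : ℝ in 𝓝 0, φ.symm (φ 1 + s • y i) ∈ V :=
      hc (by simpa [hφ] using hV)
    have hε' : ∀ᶠ s : ℝ in 𝓝 0, |s| < ε := by
      filter_upwards [Metric.ball_mem_nhds (0 : ℝ) hε] with s hs using by simpa using hs
    obtain ⟨s, hs, t, ht, hst, hmem⟩ := hK.exists_ne_div_mem hW₂
      (infinite_of_mem_nhds (0 : ℝ) (hV'.and hε')) (f := fun s => ψ (φ.symm (φ 1 + s • y i)))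
      fun s hs => hVK _ hs.1
    exact ⟨s, t, hs.2, ht.2, hst, by simpa using hmem⟩
  choose s t hs ht hst hmem using hpair
  have hx (z : E) : ∃ w : Fin (Module.finrank ℝ E) → E, ∑ i, (w i -
      chartAd I (φ.symm (φ 1 + t i • y i) * (φ.symm (φ 1 + s i • y i))⁻¹) (w i)) = z := by
    obtain ⟨w, hw⟩ := hsurj s t hs ht hst z
    -- The witness comes from `(1 - Ad (b * a⁻¹)) ∘ Ad a = Ad a - Ad b`.
    refine ⟨fun i => chartAd I (φ.symm (φ 1 + s i • y i)) (w i), ?_⟩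
    rw [← hw]
    refine Finset.sum_congr rfl fun i _ => ?_
    rw [← ContinuousLinearMap.comp_apply, ← chartAd_mul, inv_mul_cancel_right]
    rfl
  rw [Filter.mem_map]
  filter_upwards [eventually_exists_prod_commutator I _ hx hV] with g ⟨h, hh, hg⟩
  rw [Set.mem_preimage, ← hg, map_list_prod, List.map_ofFn]
  refine hprod _ (by simp) fun z hz => ?_
  obtain ⟨i, rfl⟩ := List.mem_ofFn.1 hz
  have := hmem i (ψ (h i)) (hVK _ (hh i))
  simpa using this
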